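/- Let $(M,d)$ be a Hadamard space (a complete geodesic CAT(0) metric space) and let $G:M\to(-\infty,\infty]$ be lower semicontinuous and convex along geodesics. Put $\operatorname{Dom}G=G^{-1}(\mathbb R)$, and let $|\partial G|:M\to[0,\infty]$ be the slope of $G$, $$|\partial G|(y)=\limsup_{z\to y,\ z\neq y}\frac{\max\{G(y)-G(z),0\}}{d(y,z)}\quad (y\in\operatorname{Dom}G),\qquad |\partial G|(y)=\infty\quad (G(y)=\infty),$$ where the limsup is $0$ if $y$ is an isolated point. Let $(c_t)_{t\ge 0}$ be the weak gradient flow of $G$ starting from a point $c_0\in\operatorname{Dom}G$, that is, $c_t=\lim_{m\to\infty}c^{m,m}_t$ for $t\ge 0$, where for $m\ge 1$ one sets $c^{m,0}_t=c_0$ and $c^{m,j+1}_t$ is the minimizer of $v\mapsto \tfrac12 d(v,c^{m,j}_t)^2+\tfrac tm G(v)$ on $M$. Then $c_t\in\operatorname{Dom}G$ for all $t\ge 0$, and for all $0<t<s$, $$|\partial G|(c_t)\,d(c_t,c_s)\ \ge\ G(c_t)-G(c_s)\ \ge\ |\partial G|(c_s)\,d(c_t,c_s).$$ Moreover, the left-hand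 inequality also holds for $t=0$: for all $s>0$, $$|\partial G|(c_0)\,d(c_0,c_s)\ \ge\ G(c_0)-G(c_s).$$ (Products are taken in $[0,\infty]$ with $\infty\cdot 0=0$.) -/

import Mathlib

open Set Filter Topology
open scoped ENNReal

namespace HadamardFlow

/-- A (constant speed, minimizing) geodesic `γ : [0,1] → M`; only the restriction of `γ` to `[0,1]`
matters. The equation forces `γ` to be continuous on `[0,1]`. -/
def IsGeodesic {M : Type*} [MetricSpace M] (γ : ℝ → M) : Prop :=
  ∀ s ∈ Icc (0 : ℝ) 1, ∀ t ∈ Icc (0 : ℝ) 1, dist (γ s) (γ t) = dist (γ 0) (γ 1) * |s - t|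

/-- Any two points are joined by a geodesic. -/
def IsGeodesicSpace (M : Type*) [MetricSpace M] : Prop :=
  ∀ x y : M, ∃ γ : ℝ → M, IsGeodesic γ ∧ γ 0 = x ∧ γ 1 = y

/-- The `CAT(0)` comparison inequality. For a geodesic triangle with vertices `x, y, z`, sides `g`
(from `x` to `y`) and `h` (from `x` to `z`), and any companion triangle `x', y', z'` in the
Euclidean plane, points on the two sides are at most as far apart as their companion points. The
companion point of `g a` is the point of the segment `[x', y']` with the same distances to the
endpoints, that is `AffineMap.lineMap x' y' a`; likewise for `h b`. The third side does not enter
the inequality, and it exists in every geodesic space. -/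
def IsCAT0 (M : Type*) [MetricSpace M] : Prop :=
  ∀ (x y z : M) (g h : ℝ → M),
    IsGeodesic g → g 0 = x → g 1 = y →
    IsGeodesic h → h 0 = x → h 1 = z →
    ∀ x' y' z' : EuclideanSpace ℝ (Fin 2),
      dist x' y' = dist x y → dist y' z' = dist y z → dist z' x' = dist z x →
      ∀ a ∈ Icc (0 : ℝ) 1, ∀ b ∈ Icc (0 : ℝ) 1,
        dist (g a) (h b) ≤ dist (AffineMap.lineMap x' y' a : EuclideanSpace ℝ (Fin 2))
          (AffineMap.lineMap x' z' b : EuclideanSpace ℝ (Fin 2))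

/-- A Hadamard space: a complete geodesic `CAT(0)` space. -/
structure IsHadamardSpace (M : Type*) [MetricSpace M] : Prop where
  complete : CompleteSpace M
  geodesic : IsGeodesicSpace M
  cat0 : IsCAT0 M

/-- Convexity along geodesics. It is used for functions that never take the value `-∞`, so that
every sum on the right is meaningful (with `0 * ∞ = 0`). -/
def IsConvex {M : Type*} [MetricSpace M] (G : M → EReal) : Prop :=
  ∀ γ : ℝ → M, IsGeodesic γ → ∀ t ∈ Icc (0 : ℝ) 1,
    G (γ t) ≤ ((1 - t : ℝ) : EReal) * G (γ 0) + ((t : ℝ) : EReal) * G (γ 1)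

/-- The domain `{G ∈ ℝ}`. -/
def Dom {M : Type*} (G : M → EReal) : Set M := {x | G x ≠ ⊥ ∧ G x ≠ ⊤}

open Classical in
/-- The (descending) slope `|∂G| : M → [0,∞]`. Note that `EReal.toENNReal r` is `max r 0`; the
limsup is over `z → y` with `z ≠ y`, and is `0` at an isolated point. -/
noncomputable def descendingSlope {M : Type*} [MetricSpace M] (G : M → EReal) (y : M) : ℝ≥0∞ :=
  if G y = ⊤ then ⊤
  else limsup (fun z => (G y - G z).toENNReal / edist y z) (𝓝[≠] y)

/-- `y` minimizes `v ↦ d(v,x)² / 2 + τ G(v)` over `M`. -/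
def IsProximalPoint {M : Type*} [MetricSpace M] (G : M → EReal) (τ : ℝ) (x y : M) : Prop :=
  ∀ v : M, ((dist y x ^ 2 / 2 : ℝ) : EReal) + (τ : EReal) * G y ≤
    ((dist v x ^ 2 / 2 : ℝ) : EReal) + (τ : EReal) * G v

/-- `c : [0,∞) → M` is the weak gradient flow of `G` starting from `c 0 ∈ Dom G`: the point `c t`
is the limit as `m → ∞` of `x m m t`, where `x m 0 t = c 0` and `x m (j+1) t` is the minimizer of
`v ↦ d(v, x m j t)² / 2 + (t/m) G(v)`. Only the values of `c` on `[0,∞)` matter. -/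
def IsWeakGradientFlow {M : Type*} [MetricSpace M] (G : M → EReal) (c : ℝ → M) : Prop :=
  c 0 ∈ Dom G ∧
    ∃ x : ℕ → ℕ → ℝ → M,
      (∀ m : ℕ, 1 ≤ m → ∀ t : ℝ, 0 ≤ t →
        x m 0 t = c 0 ∧
        ∀ j : ℕ, IsProximalPoint G (t / (m : ℝ)) (x m j t) (x m (j + 1) t)) ∧
      ∀ t : ℝ, 0 ≤ t → Tendsto (fun m : ℕ => x m m t) atTop (𝓝 (c t))

end HadamardFlow

namespace HadamardFlow

/-! ### Real values of `G` on its domain. -/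

section Dom

variable {M : Type*} {G : M → EReal}

/-! The upper bound on `G (c t) - G (c s)` is pure convexity: along a geodesic the difference
quotient at the starting point dominates the secant slope. The flow plays no role, so `t = 0` is
allowed.

The lower bound is proved for the discrete scheme. For a step from `x j` to `x (j + 1)` of length
`d`, the variational inequality gives that the slope at `x (j + 1)` is at most `d / τ` and that `G`
drops by at least `d ^ 2 / τ`. Hence step lengths decrease, and the last of `n` steps, divided by
`τ`, bounds both the slope at `x n` and, from below, the rate of decrease from any earlier point
(`scheme_exists_slope_bound`).

If `s / t` is rational, `c t` and `c s` are limits along the same schemes, and the estimate passes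
to the limit in its product form `SlopeLeDecrease`. For general `s`, rational ratios approach `s /
t` from above and continuity of the flow (`flow_dist_le`) concludes. -/

lemma coe_toReal_of_mem_dom {x : M} (hx : x ∈ Dom G) : (((G x).toReal : ℝ) : EReal) = G x :=
  EReal.coe_toReal hx.2 hx.1

lemma mem_dom_of_le (hbot : ∀ x, G x ≠ ⊥) {x : M} {r : ℝ} (h : G x ≤ r) : x ∈ Dom G :=
  ⟨hbot x, (h.trans_lt (EReal.coe_lt_top r)).ne⟩

end Dom

/-! ### CAT(0) geometry. -/

variable {M : Type*} [MetricSpace M]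

/-- Every triple of distances in a metric space is realized by a triangle in the plane. -/
lemma exists_comparison_triangle (x y z : M) :
    ∃ x' y' z' : EuclideanSpace ℝ (Fin 2),
      dist x' y' = dist x y ∧ dist y' z' = dist y z ∧ dist z' x' = dist z x := by
  rcases eq_or_ne x y with rfl | hxy
  · refine ⟨!₂[0, 0], !₂[0, 0], !₂[dist x z, 0], ?_, ?_, ?_⟩
    · simp
    · simp [EuclideanSpace.dist_eq, Real.dist_eq]
    · simp [EuclideanSpace.dist_eq, Real.dist_eq, dist_comm]
  · have hc : 0 < dist x y := dist_pos.2 hxy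
    set c := dist x y with hcdef
    set a := dist y z with ha
    set b := dist z x with hb
    have ha0 : 0 ≤ a := dist_nonneg
    have hb0 : 0 ≤ b := dist_nonneg
    have h1 : a ≤ c + b := by
      have := dist_triangle y x z
      rw [dist_comm y x, dist_comm x z] at this; exact this
    have h2 : b ≤ a + c := by
      have := dist_triangle z y x
      rw [dist_comm y x, dist_comm z y] at this; exact this
    have h3 : c ≤ b + a := by
      have := dist_triangle x z y
      rw [dist_comm x z, dist_comm z y] at this; exact this
    set u := (b ^ 2 + c ^ 2 - a ^ 2) / (2 * c) with hu
    have hu' : 2 * c * u = b ^ 2 + c ^ 2 - a ^ 2 := by rw [hu]; field_simp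
    have hv : 0 ≤ b ^ 2 - u ^ 2 := by
      have e : (2 * c) ^ 2 * (b ^ 2 - u ^ 2) =
          ((b + c + a) * (b + c - a)) * ((a + b - c) * (a + c - b)) := by
        have : (2 * c) ^ 2 * (b ^ 2 - u ^ 2) = (2 * c * b) ^ 2 - (2 * c * u) ^ 2 := by ring
        rw [this, hu']; ring
      have : 0 ≤ (2 * c) ^ 2 * (b ^ 2 - u ^ 2) := by
        rw [e]
        apply mul_nonneg <;> apply mul_nonneg <;> linarith
      exact nonneg_of_mul_nonneg_right this (by positivity)
    refine ⟨!₂[0, 0], !₂[c, 0], !₂[u, √(b ^ 2 - u ^ 2)], ?_, ?_, ?_⟩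
    · simp [EuclideanSpace.dist_eq, Real.sqrt_sq_eq_abs, Real.dist_eq, abs_of_pos hc]
    · simp only [EuclideanSpace.dist_eq, Fin.sum_univ_two, Real.dist_eq, sq_abs]
      simp [Real.sq_sqrt hv]
      rw [show (c - u) ^ 2 + (b ^ 2 - u ^ 2) = a ^ 2 by linear_combination -hu']
      exact Real.sqrt_sq ha0
    · simp only [EuclideanSpace.dist_eq, Fin.sum_univ_two, Real.dist_eq, sq_abs]
      simp [Real.sq_sqrt hv]
      exact Real.sqrt_sq hb0

lemma dist_lineMap_sq {E : Type*} [NormedAddCommGroup E] [InnerProductSpace ℝ E]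
    (x y z : E) (a : ℝ) :
    dist (AffineMap.lineMap x y a) z ^ 2 =
      (1 - a) * dist x z ^ 2 + a * dist y z ^ 2 - a * (1 - a) * dist x y ^ 2 := by
  have e1 : AffineMap.lineMap x y a - z = (1 - a) • (x - z) + a • (y - z) := by
    rw [AffineMap.lineMap_apply_module]; module
  have e2 : x - y = (x - z) - (y - z) := by abel
  rw [dist_eq_norm, dist_eq_norm, dist_eq_norm, dist_eq_norm, e1, e2]
  generalize x - z = p
  generalize y - z = q
  rw [norm_add_sq_real, norm_sub_sq_real, norm_smul, norm_smul, inner_smul_left, inner_smul_right,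
    mul_pow, mul_pow, Real.norm_eq_abs, Real.norm_eq_abs, sq_abs, sq_abs]
  simp only [conj_trivial]
  ring

lemma IsHadamardSpace.dist_geodesic_sq_le (hM : IsHadamardSpace M) {γ : ℝ → M}
    (hγ : IsGeodesic γ) {a : ℝ} (ha : a ∈ Icc (0 : ℝ) 1) (z : M) :
    dist (γ a) z ^ 2 ≤ (1 - a) * dist (γ 0) z ^ 2 + a * dist (γ 1) z ^ 2 -
      a * (1 - a) * dist (γ 0) (γ 1) ^ 2 := by
  obtain ⟨h, hh, h0, h1⟩ := hM.geodesic (γ 0) z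
  obtain ⟨x', y', z', e1, e2, e3⟩ := exists_comparison_triangle (γ 0) (γ 1) z
  have key := hM.cat0 (γ 0) (γ 1) z γ h hγ rfl rfl hh h0 h1 x' y' z' e1 e2 e3 a ha 1 (by simp)
  rw [h1, AffineMap.lineMap_apply_one] at key
  have := pow_le_pow_left₀ dist_nonneg key 2
  rwa [dist_lineMap_sq, e1, e2, dist_comm x' z', e3, dist_comm z] at this

/-- Reshetnyak's quadrilateral inequality. -/
lemma IsHadamardSpace.quadrilateral (hM : IsHadamardSpace M) (a b y y' : M) :
    dist a y' ^ 2 + dist b y ^ 2 ≤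
      dist a y ^ 2 + dist b y' ^ 2 + 2 * dist a b * dist y y' := by
  rcases eq_or_ne a b with rfl | hab
  · simp [add_comm]
  rcases eq_or_ne y y' with rfl | hyy
  · simp
  have hw : 0 < dist a b := dist_pos.2 hab
  have hu : 0 < dist y y' := dist_pos.2 hyy
  set w := dist a b
  set u := dist y y'
  obtain ⟨γ, hγ, h0, h1⟩ := hM.geodesic a y'
  -- This ratio balances the two estimates: weighted by `u` and `w`, they combine with `(q + r) ^ 2
  -- ≤ (u + w) * (q ^ 2 / w + r ^ 2 / u)`, the defect being the square of `q * u - r * w`.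
  have hl : w / (u + w) ∈ Icc (0 : ℝ) 1 :=
    ⟨by positivity, by rw [div_le_one (by positivity)]; linarith⟩
  have A := hM.dist_geodesic_sq_le hγ hl b
  have B := hM.dist_geodesic_sq_le hγ hl y
  rw [h0, h1] at A B
  set p := γ (w / (u + w))
  have T : dist b y ≤ dist p b + dist p y := by
    rw [dist_comm p b]; exact dist_triangle _ _ _
  rw [dist_comm y' y] at B
  change _ ≤ (1 - w / (u + w)) * w ^ 2 + _ - _ at A
  change _ ≤ _ + w / (u + w) * u ^ 2 - _ at B
  rw [dist_comm y' b] at A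
  have hs : 0 < u + w := by positivity
  have hT := pow_le_pow_left₀ dist_nonneg T 2
  generalize dist p b = q at A hT
  generalize dist p y = r at B hT
  generalize dist b y ^ 2 = X at hT ⊢
  generalize dist a y' ^ 2 = D at A B ⊢
  generalize dist b y' ^ 2 = Y at A ⊢
  generalize dist a y ^ 2 = Z at B ⊢
  have e1 : 1 - w / (u + w) = u / (u + w) := by field_simp; ring
  rw [e1] at A B
  have A' : (u + w) * q ^ 2 ≤ u * w ^ 2 + w * Y - u * w / (u + w) * D := by
    calc _ ≤ (u + w) * _ := mul_le_mul_of_nonneg_left A hs.le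
      _ = _ := by field_simp
  have B' : (u + w) * r ^ 2 ≤ u * Z + w * u ^ 2 - u * w / (u + w) * D := by
    calc _ ≤ (u + w) * _ := mul_le_mul_of_nonneg_left B hs.le
      _ = _ := by field_simp
  have hK : (u + w) * (u * w / (u + w) * D) = u * w * D := by field_simp
  have A'' := mul_le_mul_of_nonneg_left A' hu.le
  have B'' := mul_le_mul_of_nonneg_left B' hw.le
  have hX := mul_le_mul_of_nonneg_left hT (mul_pos hu hw).le
  have h2 : u * w * (D + X) ≤ u * w * (Z + Y + 2 * w * u) := by
    linarith [sq_nonneg (q * u - r * w)]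
  exact le_of_mul_le_mul_left h2 (mul_pos hu hw)

/-! ### Proximal points and slopes of convex functions. -/

section Convex

variable {G : M → EReal}

lemma IsConvex.toReal_le (hG : IsConvex G) (hbot : ∀ x, G x ≠ ⊥) {γ : ℝ → M}
    (hγ : IsGeodesic γ) (h0 : γ 0 ∈ Dom G) (h1 : γ 1 ∈ Dom G) {t : ℝ} (ht : t ∈ Icc (0 : ℝ) 1) :
    γ t ∈ Dom G ∧ (G (γ t)).toReal ≤ (1 - t) * (G (γ 0)).toReal + t * (G (γ 1)).toReal := by
  have h := hG γ hγ t ht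
  rw [← coe_toReal_of_mem_dom h0, ← coe_toReal_of_mem_dom h1, ← EReal.coe_mul, ← EReal.coe_mul,
    ← EReal.coe_add] at h
  have hd := mem_dom_of_le hbot h
  refine ⟨hd, ?_⟩
  rwa [← coe_toReal_of_mem_dom hd, EReal.coe_le_coe_iff] at h

lemma IsProximalPoint.toReal_le {τ : ℝ} {x y v : M} (h : IsProximalPoint G τ x y)
    (hy : y ∈ Dom G) (hv : v ∈ Dom G) :
    dist y x ^ 2 / 2 + τ * (G y).toReal ≤ dist v x ^ 2 / 2 + τ * (G v).toReal := by
  have h := h v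
  rw [← coe_toReal_of_mem_dom hy, ← coe_toReal_of_mem_dom hv] at h
  exact_mod_cast h

lemma IsProximalPoint.mem_dom (hbot : ∀ x, G x ≠ ⊥) {τ : ℝ} (hτ : 0 < τ) {x y v : M}
    (h : IsProximalPoint G τ x y) (hv : v ∈ Dom G) : y ∈ Dom G := by
  refine ⟨hbot y, fun hy => ?_⟩
  have h := h v
  rw [hy, ← coe_toReal_of_mem_dom hv, EReal.coe_mul_top_of_pos hτ, EReal.coe_add_top,
    ← EReal.coe_mul, ← EReal.coe_add, top_le_iff] at h
  exact EReal.coe_ne_top _ h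

/-- The variational inequality that characterizes a proximal point. -/
lemma IsProximalPoint.variational (hM : IsHadamardSpace M) (hG : IsConvex G)
    (hbot : ∀ x, G x ≠ ⊥) {τ : ℝ} (hτ : 0 < τ) {x y v : M}
    (h : IsProximalPoint G τ x y) (hv : v ∈ Dom G) :
    dist v y ^ 2 + dist y x ^ 2 + 2 * τ * (G y).toReal ≤
      dist v x ^ 2 + 2 * τ * (G v).toReal := by
  have hy := h.mem_dom hbot hτ hv
  obtain ⟨γ, hγ, h0, h1⟩ := hM.geodesic y v
  -- Compare `y` with the point of the geodesic to `v` at parameter `t`. A common factor `t`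
  -- cancels, and the remaining `1 - t` disappears as `t → 0`.
  have key : ∀ t ∈ Ioc (0 : ℝ) 1, (1 - t) * dist v y ^ 2 + dist y x ^ 2 + 2 * τ * (G y).toReal ≤
      dist v x ^ 2 + 2 * τ * (G v).toReal := by
    intro t ht
    have ht' : t ∈ Icc (0 : ℝ) 1 := ⟨ht.1.le, ht.2⟩
    obtain ⟨hd, hc⟩ := hG.toReal_le hbot hγ (h0 ▸ hy) (h1 ▸ hv) ht'
    have hp := h.toReal_le hy hd
    have hq := hM.dist_geodesic_sq_le hγ ht' x
    rw [h0, h1] at hc hq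
    rw [dist_comm y v] at hq
    have hc' := mul_le_mul_of_nonneg_left hc hτ.le
    have : t * ((1 - t) * dist v y ^ 2 + dist y x ^ 2 + 2 * τ * (G y).toReal) ≤
        t * (dist v x ^ 2 + 2 * τ * (G v).toReal) := by linarith
    exact le_of_mul_le_mul_left this ht.1
  have hlim : Tendsto (fun t : ℝ => (1 - t) * dist v y ^ 2 + dist y x ^ 2 + 2 * τ * (G y).toReal)
      (𝓝[>] 0) (𝓝 ((1 - 0) * dist v y ^ 2 + dist y x ^ 2 + 2 * τ * (G y).toReal)) :=
    (Continuous.tendsto (by fun_prop) 0).mono_left nhdsWithin_le_nhds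
  rw [sub_zero, one_mul] at hlim
  refine le_of_tendsto hlim ?_
  filter_upwards [Ioc_mem_nhdsGT (zero_lt_one' ℝ)] with t ht using key t ht

/-- The slope of `G` at a proximal point is at most `dist y x / τ`. -/
lemma IsProximalPoint.toReal_sub_le (hM : IsHadamardSpace M) (hG : IsConvex G)
    (hbot : ∀ x, G x ≠ ⊥) {τ : ℝ} (hτ : 0 < τ) {x y z : M}
    (h : IsProximalPoint G τ x y) (hz : z ∈ Dom G) :
    τ * ((G y).toReal - (G z).toReal) ≤ dist y x * dist y z := by
  have hv := h.variational hM hG hbot hτ hz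
  have ht : dist z x ≤ dist y z + dist y x := by
    rw [dist_comm y z]; exact dist_triangle _ _ _
  have := pow_le_pow_left₀ dist_nonneg ht 2
  rw [dist_comm z y] at hv
  linarith

/-- Proximal points with step sizes `τ ≤ τ'` are close if their base points are. -/
lemma IsProximalPoint.dist_le (hM : IsHadamardSpace M) (hG : IsConvex G)
    (hbot : ∀ x, G x ≠ ⊥) {τ τ' : ℝ} (hτ : 0 < τ) (hττ' : τ ≤ τ') {a b y y' v : M}
    (h : IsProximalPoint G τ a y) (h' : IsProximalPoint G τ' b y') (hv : v ∈ Dom G) :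
    dist y y' ≤ dist a b + (τ' / τ - 1) * dist y a := by
  have hτ' : 0 < τ' := hτ.trans_le hττ'
  have V := h.variational hM hG hbot hτ (h'.mem_dom hbot hτ' hv)
  have V' := h'.variational hM hG hbot hτ' (h.mem_dom hbot hτ hv)
  have Q := hM.quadrilateral a b y y'
  have T : dist y' a ≤ dist y y' + dist y a := by
    rw [dist_comm y y']; exact dist_triangle _ _ _
  have T2 := pow_le_pow_left₀ dist_nonneg T 2
  rw [dist_comm y' y] at V
  rw [dist_comm a y', dist_comm a y, dist_comm b y, dist_comm b y'] at Q
  -- The weights `τ'` and `τ` make the values of `G` cancel.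
  have W : τ' * (dist y y' ^ 2 + dist y a ^ 2) + τ * (dist y y' ^ 2 + dist y' b ^ 2) ≤
      τ' * dist y' a ^ 2 + τ * dist y b ^ 2 := by
    linarith [mul_le_mul_of_nonneg_left V hτ'.le, mul_le_mul_of_nonneg_left V' hτ.le]
  have Q' := mul_le_mul_of_nonneg_left Q hτ.le
  have T' := mul_le_mul_of_nonneg_left T2 (sub_nonneg.2 hττ')
  have F : dist y y' * (τ * dist y y') ≤
      dist y y' * (τ * dist a b + (τ' - τ) * dist y a) := by linarith
  rcases (dist_nonneg : 0 ≤ dist y y').eq_or_lt with h0 | h0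
  · rw [← h0]
    have : 0 ≤ τ' / τ - 1 := by rw [sub_nonneg, one_le_div hτ]; exact hττ'
    positivity
  · have F' := le_of_mul_le_mul_left F h0
    have : τ * dist y y' ≤ τ * (dist a b + (τ' / τ - 1) * dist y a) := by
      calc _ ≤ _ := F'
        _ = _ := by field_simp
    exact le_of_mul_le_mul_left this hτ

/-- By convexity the difference quotients at `y` along the geodesic to `z` are at least the secant
slope `K`, and these points tend to `y`. -/
lemma IsConvex.sub_le_descendingSlope_mul (hM : IsHadamardSpace M) (hG : IsConvex G)
    (hbot : ∀ x, G x ≠ ⊥) {y z : M} (hy : y ∈ Dom G) (hz : z ∈ Dom G) :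
    G y - G z ≤ (descendingSlope G y : EReal) * (dist y z : EReal) := by
  rw [← coe_toReal_of_mem_dom hy, ← coe_toReal_of_mem_dom hz, ← EReal.coe_sub]
  rcases eq_or_ne y z with rfl | hyz
  · simp
  have hd : 0 < dist y z := dist_pos.2 hyz
  set K := ((G y).toReal - (G z).toReal) / dist y z with hK
  have hKd : (G y).toReal - (G z).toReal = K * dist y z := by rw [hK]; field_simp
  suffices hS : ENNReal.ofReal K ≤ descendingSlope G y by
    have h1 : (K : EReal) ≤ (descendingSlope G y : EReal) :=
      calc (K : EReal) ≤ ((ENNReal.ofReal K : ℝ≥0∞) : EReal) := by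
            rw [EReal.coe_ennreal_ofReal]; exact_mod_cast le_max_left K 0
        _ ≤ _ := EReal.coe_ennreal_le_coe_ennreal_iff.2 hS
    rw [hKd, EReal.coe_mul]
    exact mul_le_mul_of_nonneg_right h1 (by exact_mod_cast hd.le)
  rw [descendingSlope, if_neg hy.2]
  obtain ⟨γ, hγ, h0, h1⟩ := hM.geodesic y z
  have hdist : ∀ t ∈ Ioc (0 : ℝ) 1, dist y (γ t) = dist y z * t := by
    intro t ht
    have := hγ 0 (by simp) t ⟨ht.1.le, ht.2⟩
    rwa [h0, h1, zero_sub, abs_neg, abs_of_pos ht.1] at this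
  have hmem : ∀ᶠ t : ℝ in 𝓝[>] 0, t ∈ Ioc (0 : ℝ) 1 := Ioc_mem_nhdsGT (zero_lt_one' ℝ)
  have hT : Tendsto γ (𝓝[>] 0) (𝓝[≠] y) := by
    refine tendsto_nhdsWithin_iff.2 ⟨?_, ?_⟩
    · rw [tendsto_iff_dist_tendsto_zero]
      have hlim : Tendsto (fun t : ℝ => dist y z * t) (𝓝[>] 0) (𝓝 (dist y z * 0)) :=
        (Continuous.tendsto (by fun_prop) 0).mono_left nhdsWithin_le_nhds
      rw [mul_zero] at hlim
      refine hlim.congr' ?_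
      filter_upwards [hmem] with t ht
      rw [dist_comm (γ t), hdist t ht]
    · filter_upwards [hmem] with t ht
      have : 0 < dist y (γ t) := by rw [hdist t ht]; exact mul_pos hd ht.1
      exact (dist_pos.1 this).symm
  refine le_limsup_of_frequently_le (hT.frequently (Eventually.frequently ?_))
    (by isBoundedDefault)
  filter_upwards [hmem] with t ht
  obtain ⟨hd', hc⟩ := hG.toReal_le hbot hγ (h0 ▸ hy) (h1 ▸ hz) ⟨ht.1.le, ht.2⟩
  rw [h0, h1] at hc
  have hpos : 0 < dist y z * t := mul_pos hd ht.1
  rw [← coe_toReal_of_mem_dom hy, ← coe_toReal_of_mem_dom hd', ← EReal.coe_sub,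
    EReal.toENNReal_of_ne_top (EReal.coe_ne_top _), EReal.toReal_coe, edist_dist, hdist t ht,
    ← ENNReal.ofReal_div_of_pos hpos]
  refine ENNReal.ofReal_le_ofReal ((le_div_iff₀ hpos).2 ?_)
  rw [← mul_assoc, ← hKd]
  linarith

lemma descendingSlope_le (hbot : ∀ x, G x ≠ ⊥) {y : M} (hy : y ∈ Dom G) {K : ℝ}
    (h : ∀ z ∈ Dom G, (G y).toReal - (G z).toReal ≤ K * dist y z) :
    descendingSlope G y ≤ ENNReal.ofReal K := by
  rw [descendingSlope, if_neg hy.2]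
  refine limsup_le_of_le (by isBoundedDefault) ?_
  filter_upwards [self_mem_nhdsWithin] with z hz
  have hd : 0 < dist y z := dist_pos.2 (Ne.symm hz)
  by_cases hzt : G z = ⊤
  · simp [hzt]
  have hzd : z ∈ Dom G := ⟨hbot z, hzt⟩
  rw [← coe_toReal_of_mem_dom hy, ← coe_toReal_of_mem_dom hzd, ← EReal.coe_sub,
    EReal.toENNReal_of_ne_top (EReal.coe_ne_top _), EReal.toReal_coe, edist_dist]
  rw [← ENNReal.ofReal_div_of_pos hd]
  exact ENNReal.ofReal_le_ofReal ((div_le_iff₀ hd).2 (h z hzd))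

end Convex

/-! ### The discrete scheme with a fixed step size. -/

section Scheme

variable {G : M → EReal} {τ : ℝ} {x : ℕ → M}

lemma scheme_mem_dom (hbot : ∀ x, G x ≠ ⊥) (hτ : 0 < τ)
    (hx : ∀ j, IsProximalPoint G τ (x j) (x (j + 1))) (h0 : x 0 ∈ Dom G) (j : ℕ) :
    x j ∈ Dom G := by
  induction j with
  | zero => exact h0
  | succ j ih => exact (hx j).mem_dom hbot hτ ih

/-- Testing the variational inequality at the base point counts the squared step twice, which
improves on plain minimality by a factor 2. The sharp constant is what makes the step lengths
monotone. -/
lemma scheme_dist_sq_le (hM : IsHadamardSpace M) (hG : IsConvex G) (hbot : ∀ x, G x ≠ ⊥)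
    (hτ : 0 < τ) (hx : ∀ j, IsProximalPoint G τ (x j) (x (j + 1))) (h0 : x 0 ∈ Dom G) (j : ℕ) :
    dist (x (j + 1)) (x j) ^ 2 ≤ τ * ((G (x j)).toReal - (G (x (j + 1))).toReal) := by
  have h := (hx j).variational hM hG hbot hτ (scheme_mem_dom hbot hτ hx h0 j)
  rw [dist_self, dist_comm (x j)] at h
  linarith

/-- The drop of `τ * G` in the next step is at least the square of its length and, by the slope
bound, at most the product of the two lengths. -/
lemma scheme_antitone_dist (hM : IsHadamardSpace M) (hG : IsConvex G) (hbot : ∀ x, G x ≠ ⊥)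
    (hτ : 0 < τ) (hx : ∀ j, IsProximalPoint G τ (x j) (x (j + 1))) (h0 : x 0 ∈ Dom G) :
    Antitone fun j => dist (x (j + 1)) (x j) := by
  refine antitone_nat_of_succ_le fun j => ?_
  have h1 := scheme_dist_sq_le hM hG hbot hτ hx h0 (j + 1)
  have h2 := (hx j).toReal_sub_le hM hG hbot hτ (scheme_mem_dom hbot hτ hx h0 (j + 2))
  rw [dist_comm (x (j + 1)) (x (j + 2))] at h2
  rcases (dist_nonneg : 0 ≤ dist (x (j + 1 + 1)) (x (j + 1))).eq_or_lt with h | h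
  · rw [← h]; exact dist_nonneg
  · refine le_of_mul_le_mul_right ?_ h
    rw [← sq]
    exact h1.trans h2

lemma scheme_mul_dist_le (hM : IsHadamardSpace M) (hG : IsConvex G) (hbot : ∀ x, G x ≠ ⊥)
    (hτ : 0 < τ) (hx : ∀ j, IsProximalPoint G τ (x j) (x (j + 1))) (h0 : x 0 ∈ Dom G)
    {δ : ℝ} (hδ : 0 ≤ δ) (p n : ℕ) (h : ∀ j < p + n, δ ≤ dist (x (j + 1)) (x j)) :
    δ * dist (x p) (x (p + n)) ≤ τ * ((G (x p)).toReal - (G (x (p + n))).toReal) := by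
  induction n with
  | zero => simp
  | succ n ih =>
    have ih := ih fun j hj => h j (by omega)
    have h1 := h (p + n) (by omega)
    have h2 := scheme_dist_sq_le hM hG hbot hτ hx h0 (p + n)
    have h3 : dist (x p) (x (p + n + 1)) ≤ dist (x p) (x (p + n)) + dist (x (p + n + 1)) (x (p + n)) := by
      rw [dist_comm (x (p + n + 1))]; exact dist_triangle _ _ _
    have h4 := mul_le_mul_of_nonneg_left h3 hδ
    have h5 := mul_le_mul_of_nonneg_right h1 (dist_nonneg : 0 ≤ dist (x (p + n + 1)) (x (p + n)))
    rw [← add_assoc]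
    linarith

lemma scheme_sq_mul_le (hM : IsHadamardSpace M) (hG : IsConvex G) (hbot : ∀ x, G x ≠ ⊥)
    (hτ : 0 < τ) (hx : ∀ j, IsProximalPoint G τ (x j) (x (j + 1))) (h0 : x 0 ∈ Dom G)
    {δ : ℝ} (hδ : 0 ≤ δ) (n : ℕ) (h : ∀ j < n, δ ≤ dist (x (j + 1)) (x j)) :
    n * δ ^ 2 ≤ τ * ((G (x 0)).toReal - (G (x n)).toReal) := by
  induction n with
  | zero => simp
  | succ n ih =>
    have ih := ih fun j hj => h j (by omega)
    have h1 := pow_le_pow_left₀ hδ (h n (by omega)) 2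
    have h2 := scheme_dist_sq_le hM hG hbot hτ hx h0 n
    push_cast
    linarith

/-- After `n ≥ 1` steps the slope is bounded by some `L` that is controlled by the total decrease
of `G`, and by the decrease of `G` relative to the distance from any earlier point. -/
lemma scheme_exists_slope_bound (hM : IsHadamardSpace M) (hG : IsConvex G) (hbot : ∀ x, G x ≠ ⊥)
    (hτ : 0 < τ) (hx : ∀ j, IsProximalPoint G τ (x j) (x (j + 1))) (h0 : x 0 ∈ Dom G)
    {n : ℕ} (hn : 0 < n) :
    ∃ L : ℝ, L ^ 2 * (n * τ) ≤ (G (x 0)).toReal - (G (x n)).toReal ∧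
      (∀ z ∈ Dom G, (G (x n)).toReal - (G z).toReal ≤ L * dist (x n) z) ∧
      ∀ p ≤ n, L * dist (x p) (x n) ≤ (G (x p)).toReal - (G (x n)).toReal := by
  obtain ⟨n, rfl⟩ : ∃ k, n = k + 1 := ⟨n - 1, by omega⟩
  have hanti := scheme_antitone_dist hM hG hbot hτ hx h0
  have hle : ∀ j < n + 1, dist (x (n + 1)) (x n) ≤ dist (x (j + 1)) (x j) :=
    fun j hj => hanti (by omega : j ≤ n)
  set δ := dist (x (n + 1)) (x n) with hδ
  have hδ0 : 0 ≤ δ := dist_nonneg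
  refine ⟨δ / τ, ?_, fun z hz => ?_, fun p hp => ?_⟩
  · have h := scheme_sq_mul_le hM hG hbot hτ hx h0 hδ0 (n + 1) hle
    refine le_of_mul_le_mul_left (le_trans (le_of_eq ?_) h) hτ
    field_simp
  · have h := (hx n).toReal_sub_le hM hG hbot hτ hz
    refine le_of_mul_le_mul_left (h.trans (le_of_eq ?_)) hτ
    field_simp
    exact (mul_comm _ _).trans (by rw [hδ, mul_comm])
  · obtain ⟨k, hk⟩ := Nat.exists_eq_add_of_le hp
    have h := scheme_mul_dist_le hM hG hbot hτ hx h0 hδ0 p k (by rwa [← hk])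
    rw [← hk] at h
    refine le_of_mul_le_mul_left (le_trans (le_of_eq ?_) h) hτ
    field_simp

/-- Each step adds an error `τ' / τ - 1` times its length, and the lengths sum to at most `n * τ`
plus the drop of `G`. Equal step sizes give uniqueness of the scheme. -/
lemma scheme_dist_le (hM : IsHadamardSpace M) (hG : IsConvex G) (hbot : ∀ x, G x ≠ ⊥)
    (hτ : 0 < τ) (hx : ∀ j, IsProximalPoint G τ (x j) (x (j + 1))) (h0 : x 0 ∈ Dom G)
    {τ' : ℝ} (hττ' : τ ≤ τ') {x' : ℕ → M} (hx' : ∀ j, IsProximalPoint G τ' (x' j) (x' (j + 1)))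
    (h00 : x 0 = x' 0) (n : ℕ) :
    dist (x n) (x' n) ≤ (τ' / τ - 1) * (n * τ + ((G (x 0)).toReal - (G (x n)).toReal)) := by
  have hr : 0 ≤ τ' / τ - 1 := by rw [sub_nonneg, one_le_div hτ]; exact hττ'
  induction n with
  | zero => simp [h00]
  | succ n ih =>
    have h1 := (hx n).dist_le hM hG hbot hτ hττ' (hx' n) h0
    have h2 := scheme_dist_sq_le hM hG hbot hτ hx h0 n
    have h3 : dist (x (n + 1)) (x n) ≤ τ + ((G (x n)).toReal - (G (x (n + 1))).toReal) := by
      refine le_of_mul_le_mul_left ?_ hτ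
      nlinarith [sq_nonneg (τ - dist (x (n + 1)) (x n)), sq_nonneg τ,
        sq_nonneg (dist (x (n + 1)) (x n))]
    have h4 := mul_le_mul_of_nonneg_left h3 hr
    push_cast
    linarith

end Scheme

/-! ### Passage to the limit. -/

section Flow

variable {G : M → EReal}

lemma eventually_sub_le_toReal (hlsc : LowerSemicontinuous G) {ι : Type*} {l : Filter ι}
    {q : ι → M} {Q : M} (hQ : Q ∈ Dom G) (hq : Tendsto q l (𝓝 Q)) (hqd : ∀ k, q k ∈ Dom G)
    {ε : ℝ} (hε : 0 < ε) : ∀ᶠ k in l, (G Q).toReal - ε ≤ (G (q k)).toReal := by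
  have h : (((G Q).toReal - ε : ℝ) : EReal) < G Q := by
    rw [← coe_toReal_of_mem_dom hQ, EReal.toReal_coe, EReal.coe_lt_coe_iff]
    linarith
  filter_upwards [hq.eventually (hlsc Q _ h)] with k hk
  rw [← coe_toReal_of_mem_dom (hqd k), gt_iff_lt, EReal.coe_lt_coe_iff] at hk
  exact hk.le

/-- For `p ≠ q` this says that the slope of `G` at `q` is at most the rate of decrease of `G` from
`p` to `q`. -/
def SlopeLeDecrease (G : M → EReal) (p q : M) : Prop :=
  ∀ z ∈ Dom G, dist p q * ((G q).toReal - (G z).toReal) ≤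
    ((G p).toReal - (G q).toReal) * dist q z

/-- Only lower bounds on `G (q k)` are needed, so lower semicontinuity suffices there; `G (p k)`
must be bounded from above, hence `hpP`. -/
lemma SlopeLeDecrease.of_tendsto (hlsc : LowerSemicontinuous G) {ι : Type*} {l : Filter ι}
    [l.NeBot] {p q : ι → M} {P Q : M} (hQ : Q ∈ Dom G)
    (hp : Tendsto p l (𝓝 P)) (hq : Tendsto q l (𝓝 Q)) (hqd : ∀ k, q k ∈ Dom G)
    (hpP : ∀ ε > 0, ∀ᶠ k in l, (G (p k)).toReal ≤ (G P).toReal + ε)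
    (h : ∀ k, SlopeLeDecrease G (p k) (q k)) : SlopeLeDecrease G P Q := by
  intro z hz
  have hpq : Tendsto (fun k => dist (p k) (q k)) l (𝓝 (dist P Q)) := hp.dist hq
  have hqz : Tendsto (fun k => dist (q k) z) l (𝓝 (dist Q z)) := hq.dist tendsto_const_nhds
  have key : ∀ ε > 0, dist P Q * ((G Q).toReal - ε - (G z).toReal) ≤
      ((G P).toReal + ε - ((G Q).toReal - ε)) * dist Q z := by
    intro ε hε
    refine le_of_tendsto_of_tendsto (hpq.mul_const _) (hqz.const_mul _) ?_
    filter_upwards [hpP ε hε, eventually_sub_le_toReal hlsc hQ hq hqd hε] with k h1 h2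
    have h3 := h k z hz
    have h4 := mul_le_mul_of_nonneg_left h2 (dist_nonneg : 0 ≤ dist (p k) (q k))
    have h5 := mul_le_mul_of_nonneg_right h1 (dist_nonneg : 0 ≤ dist (q k) z)
    have h6 := mul_le_mul_of_nonneg_right h2 (dist_nonneg : 0 ≤ dist (q k) z)
    linarith
  have L1 : Tendsto (fun ε : ℝ => dist P Q * ((G Q).toReal - ε - (G z).toReal)) (𝓝[>] 0)
      (𝓝 (dist P Q * ((G Q).toReal - 0 - (G z).toReal))) :=
    (Continuous.tendsto (by fun_prop) 0).mono_left nhdsWithin_le_nhds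
  have L2 : Tendsto (fun ε : ℝ => ((G P).toReal + ε - ((G Q).toReal - ε)) * dist Q z) (𝓝[>] 0)
      (𝓝 (((G P).toReal + 0 - ((G Q).toReal - 0)) * dist Q z)) :=
    (Continuous.tendsto (by fun_prop) 0).mono_left nhdsWithin_le_nhds
  rw [sub_zero] at L1
  rw [sub_zero, add_zero] at L2
  refine le_of_tendsto_of_tendsto L1 L2 ?_
  filter_upwards [self_mem_nhdsWithin] with ε hε using key ε hε

lemma SlopeLeDecrease.descendingSlope_mul_le (hbot : ∀ x, G x ≠ ⊥) {p q : M} (hp : p ∈ Dom G)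
    (hq : q ∈ Dom G) (h : SlopeLeDecrease G p q) :
    (descendingSlope G q : EReal) * (dist p q : EReal) ≤ G p - G q := by
  rw [← coe_toReal_of_mem_dom hp, ← coe_toReal_of_mem_dom hq, ← EReal.coe_sub]
  rcases eq_or_ne p q with rfl | hpq
  · simp
  have hd : 0 < dist p q := dist_pos.2 hpq
  set K := ((G p).toReal - (G q).toReal) / dist p q with hK
  have hKd : (G p).toReal - (G q).toReal = K * dist p q := by rw [hK]; field_simp
  -- Nonnegativity comes from the choice `z = p`.
  have hK0 : 0 ≤ K := by
    have h1 := h p hp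
    rw [dist_comm q p, ← neg_sub (G p).toReal, hKd] at h1
    have h2 : 0 ≤ dist p q * dist p q * K := by linarith
    exact nonneg_of_mul_nonneg_right h2 (by positivity)
  have hS := descendingSlope_le hbot hq (K := K) fun z hz => by
    refine le_of_mul_le_mul_left ((h z hz).trans (le_of_eq ?_)) hd
    rw [hKd]; ring
  have h1 : (descendingSlope G q : EReal) ≤ (K : EReal) := by
    calc _ ≤ ((ENNReal.ofReal K : ℝ≥0∞) : EReal) := EReal.coe_ennreal_le_coe_ennreal_iff.2 hS
      _ = _ := by rw [EReal.coe_ennreal_ofReal, max_eq_left hK0]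
  rw [hKd, EReal.coe_mul]
  exact mul_le_mul_of_nonneg_right h1 (by exact_mod_cast hd.le)

variable {c : ℝ → M} {x : ℕ → ℕ → ℝ → M}

lemma tendsto_mul_succ_atTop {a : ℕ} (ha : 0 < a) :
    Tendsto (fun k : ℕ => a * (k + 1)) atTop atTop :=
  ((tendsto_add_atTop_nat 1).const_mul_atTop' ha)

lemma scheme_toReal_le_head (hM : IsHadamardSpace M) (hG : IsConvex G)
    (hbot : ∀ x, G x ≠ ⊥) {τ : ℝ} (hτ : 0 < τ) {x : ℕ → M}
    (hx : ∀ j, IsProximalPoint G τ (x j) (x (j + 1))) (h0 : x 0 ∈ Dom G) (n : ℕ) :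
    (G (x n)).toReal ≤ (G (x 0)).toReal := by
  have h := scheme_sq_mul_le hM hG hbot hτ hx h0 le_rfl n fun _ _ => dist_nonneg
  rw [zero_pow two_ne_zero, mul_zero] at h
  linarith [nonneg_of_mul_nonneg_right h hτ]

lemma mem_dom_of_tendsto (hlsc : LowerSemicontinuous G) (hbot : ∀ x, G x ≠ ⊥) {q : ℕ → M}
    {Q : M} (hq : Tendsto q atTop (𝓝 Q)) {C : ℝ} (h : ∀ᶠ k in atTop, G (q k) ≤ C) :
    Q ∈ Dom G := by
  refine mem_dom_of_le hbot (r := C) (le_of_not_gt fun hC => ?_)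
  obtain ⟨k, h1, h2⟩ := ((hq.eventually (hlsc Q _ hC)).and h).exists
  exact h1.not_ge h2

lemma flow_mem_dom (hM : IsHadamardSpace M) (hG : IsConvex G) (hbot : ∀ x, G x ≠ ⊥)
    (hlsc : LowerSemicontinuous G) (h0 : c 0 ∈ Dom G)
    (hx : ∀ m : ℕ, 1 ≤ m → ∀ t : ℝ, 0 ≤ t → x m 0 t = c 0 ∧
      ∀ j : ℕ, IsProximalPoint G (t / (m : ℝ)) (x m j t) (x m (j + 1) t))
    (hlim : ∀ t : ℝ, 0 ≤ t → Tendsto (fun m : ℕ => x m m t) atTop (𝓝 (c t)))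
    {t : ℝ} (ht : 0 ≤ t) : c t ∈ Dom G := by
  rcases ht.eq_or_lt with rfl | ht'
  · exact h0
  refine mem_dom_of_tendsto hlsc hbot (hlim t ht) (C := (G (c 0)).toReal) ?_
  filter_upwards [eventually_ge_atTop 1] with m hm
  obtain ⟨h1, h2⟩ := hx m hm t ht
  have hτ : 0 < t / (m : ℝ) := div_pos ht' (by exact_mod_cast hm)
  have hd : x m 0 t ∈ Dom G := h1 ▸ h0
  rw [← coe_toReal_of_mem_dom (scheme_mem_dom (x := fun j => x m j t) hbot hτ h2 hd m), ← h1,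
    EReal.coe_le_coe_iff]
  exact scheme_toReal_le_head (x := fun j => x m j t) hM hG hbot hτ h2 hd m

lemma flow_dist_le (hM : IsHadamardSpace M) (hG : IsConvex G) (hbot : ∀ x, G x ≠ ⊥)
    (hlsc : LowerSemicontinuous G) (h0 : c 0 ∈ Dom G)
    (hx : ∀ m : ℕ, 1 ≤ m → ∀ t : ℝ, 0 ≤ t → x m 0 t = c 0 ∧
      ∀ j : ℕ, IsProximalPoint G (t / (m : ℝ)) (x m j t) (x m (j + 1) t))
    (hlim : ∀ t : ℝ, 0 ≤ t → Tendsto (fun m : ℕ => x m m t) atTop (𝓝 (c t)))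
    {s s' : ℝ} (hs : 0 < s) (hss' : s ≤ s') :
    dist (c s) (c s') ≤ (s' / s - 1) * (s + (G (c 0)).toReal - (G (c s)).toReal + 1) := by
  have hr : 0 ≤ s' / s - 1 := by rw [sub_nonneg, one_le_div hs]; exact hss'
  have hcs := flow_mem_dom hM hG hbot hlsc h0 hx hlim hs.le
  -- The shift avoids `m = 0`, where the scheme is unspecified.
  have hlim1 := (hlim s hs.le).comp (tendsto_add_atTop_nat 1)
  have hlim2 := (hlim s' (hs.le.trans hss')).comp (tendsto_add_atTop_nat 1)
  have hτ : ∀ k : ℕ, 0 < s / ((k + 1 : ℕ) : ℝ) := fun k => by positivity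
  have hd : ∀ k, x (k + 1) (k + 1) s ∈ Dom G := fun k => by
    obtain ⟨h1, h2⟩ := hx (k + 1) (by omega) s hs.le
    exact scheme_mem_dom (x := fun j => x (k + 1) j s) hbot (hτ k) h2 (h1 ▸ h0) (k + 1)
  refine le_of_tendsto (hlim1.dist hlim2) ?_
  filter_upwards [eventually_sub_le_toReal hlsc hcs hlim1 hd one_pos] with k hk
  obtain ⟨h1, h2⟩ := hx (k + 1) (by omega) s hs.le
  obtain ⟨h1', h2'⟩ := hx (k + 1) (by omega) s' (hs.le.trans hss')
  have h := scheme_dist_le (x := fun j => x (k + 1) j s) (x' := fun j => x (k + 1) j s')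
    hM hG hbot (hτ k) h2 (h1 ▸ h0) (by gcongr) h2' (h1.trans h1'.symm) (k + 1)
  have e1 : s' / ((k + 1 : ℕ) : ℝ) / (s / ((k + 1 : ℕ) : ℝ)) = s' / s := by field_simp
  have e2 : ((k + 1 : ℕ) : ℝ) * (s / ((k + 1 : ℕ) : ℝ)) = s := by field_simp
  simp only [h1] at h
  rw [e1, e2] at h
  refine h.trans (mul_le_mul_of_nonneg_left ?_ hr)
  simp only [Function.comp] at hk
  linarith

/-- With `a * (k + 1)` steps up to `t` and `b * (k + 1)` up to `s` the step sizes agree, so by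
uniqueness both approximations lie on one scheme. -/
lemma flow_slopeLeDecrease_of_commensurable (hM : IsHadamardSpace M) (hG : IsConvex G)
    (hbot : ∀ x, G x ≠ ⊥) (hlsc : LowerSemicontinuous G) (h0 : c 0 ∈ Dom G)
    (hx : ∀ m : ℕ, 1 ≤ m → ∀ t : ℝ, 0 ≤ t → x m 0 t = c 0 ∧
      ∀ j : ℕ, IsProximalPoint G (t / (m : ℝ)) (x m j t) (x m (j + 1) t))
    (hlim : ∀ t : ℝ, 0 ≤ t → Tendsto (fun m : ℕ => x m m t) atTop (𝓝 (c t)))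
    {t s : ℝ} (ht : 0 < t) {a b : ℕ} (ha : 0 < a) (hab : a ≤ b) (hs : a * s = b * t) :
    SlopeLeDecrease G (c t) (c s) := by
  have hb : 0 < b := ha.trans_le hab
  have ha' : (0 : ℝ) < a := by exact_mod_cast ha
  have hb' : (0 : ℝ) < b := by exact_mod_cast hb
  have hs0 : 0 < s := pos_of_mul_pos_right (hs ▸ mul_pos hb' ht) ha'.le
  have hct := flow_mem_dom hM hG hbot hlsc h0 hx hlim ht.le
  have hcs := flow_mem_dom hM hG hbot hlsc h0 hx hlim hs0.le
  have hlim1 := (hlim t ht.le).comp (tendsto_mul_succ_atTop ha)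
  have hlim2 := (hlim s hs0.le).comp (tendsto_mul_succ_atTop hb)
  set y : ℕ → ℕ → M := fun k j => x (a * (k + 1)) j t with hy
  have hy0 : ∀ k, y k 0 = c 0 := fun k => (hx (a * (k + 1)) (Nat.mul_pos ha k.succ_pos) t ht.le).1
  have hyp : ∀ k j, IsProximalPoint G (t / ((a * (k + 1) : ℕ) : ℝ)) (y k j) (y k (j + 1)) :=
    fun k => (hx (a * (k + 1)) (Nat.mul_pos ha k.succ_pos) t ht.le).2
  have hτ : ∀ k : ℕ, 0 < t / ((a * (k + 1) : ℕ) : ℝ) := fun k => by positivity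
  have hyd : ∀ k j, y k j ∈ Dom G := fun k =>
    scheme_mem_dom hbot (hτ k) (hyp k) ((hy0 k).symm ▸ h0)
  have hxy : ∀ k, x (b * (k + 1)) (b * (k + 1)) s = y k (b * (k + 1)) := by
    intro k
    obtain ⟨h1, h2⟩ := hx (b * (k + 1)) (Nat.mul_pos hb k.succ_pos) s hs0.le
    have e : s / ((b * (k + 1) : ℕ) : ℝ) = t / ((a * (k + 1) : ℕ) : ℝ) := by
      push_cast
      field_simp
      linarith
    rw [e] at h2
    have h := scheme_dist_le (x' := fun j => x (b * (k + 1)) j s) hM hG hbot (hτ k) (hyp k)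
      ((hy0 k).symm ▸ h0) le_rfl h2 ((hy0 k).trans h1.symm) (b * (k + 1))
    rw [div_self (hτ k).ne', sub_self, zero_mul] at h
    exact (dist_le_zero.1 h).symm
  replace hlim1 : Tendsto (fun k => y k (a * (k + 1))) atTop (𝓝 (c t)) := hlim1
  replace hlim2 : Tendsto (fun k => y k (b * (k + 1))) atTop (𝓝 (c s)) :=
    hlim2.congr fun k => hxy k
  refine SlopeLeDecrease.of_tendsto hlsc hcs hlim1 hlim2 (fun k => hyd k _) ?_ ?_
  · intro ε hε
    -- Since `t > 0`, the total drop of `G` bounds `L ^ 2` uniformly in `k`, and `L ≤ 1 + L ^ 2`. A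
    -- uniform slope bound at points tending to `c t` keeps their values from exceeding `G (c t)` in
    -- the limit.
    set C := 1 + ((G (c 0)).toReal - ((G (c t)).toReal - 1)) / t with hC
    have hdist : Tendsto (fun k => C * dist (y k (a * (k + 1))) (c t)) atTop (𝓝 0) := by
      have := (tendsto_iff_dist_tendsto_zero.1 hlim1).const_mul C
      rwa [mul_zero] at this
    filter_upwards [hdist.eventually (gt_mem_nhds hε),
      eventually_sub_le_toReal hlsc hct hlim1 (fun k => hyd k _) one_pos] with k h1 h2
    obtain ⟨L, hL1, hL2, -⟩ := scheme_exists_slope_bound hM hG hbot (hτ k) (hyp k)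
      ((hy0 k).symm ▸ h0) (Nat.mul_pos ha k.succ_pos)
    have e : ((a * (k + 1) : ℕ) : ℝ) * (t / ((a * (k + 1) : ℕ) : ℝ)) = t := by field_simp
    rw [e, hy0] at hL1
    have hL3 : L ^ 2 ≤ ((G (c 0)).toReal - ((G (c t)).toReal - 1)) / t := by
      rw [le_div_iff₀ ht]; linarith
    have hLC : L ≤ C := by nlinarith [sq_nonneg (L - 1), sq_nonneg L]
    have := mul_le_mul_of_nonneg_right hLC (dist_nonneg : 0 ≤ dist (y k (a * (k + 1))) (c t))
    linarith [hL2 (c t) hct]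
  · intro k z hz
    obtain ⟨L, -, hL2, hL3⟩ := scheme_exists_slope_bound hM hG hbot (hτ k) (hyp k)
      ((hy0 k).symm ▸ h0) (Nat.mul_pos hb k.succ_pos)
    have h1 := mul_le_mul_of_nonneg_left (hL2 z hz)
      (dist_nonneg : 0 ≤ dist (y k (a * (k + 1))) (y k (b * (k + 1))))
    have h2 := mul_le_mul_of_nonneg_right (hL3 (a * (k + 1)) (Nat.mul_le_mul_right _ hab))
      (dist_nonneg : 0 ≤ dist (y k (b * (k + 1))) z)
    linarith

lemma flow_slopeLeDecrease (hM : IsHadamardSpace M) (hG : IsConvex G)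
    (hbot : ∀ x, G x ≠ ⊥) (hlsc : LowerSemicontinuous G) (h0 : c 0 ∈ Dom G)
    (hx : ∀ m : ℕ, 1 ≤ m → ∀ t : ℝ, 0 ≤ t → x m 0 t = c 0 ∧
      ∀ j : ℕ, IsProximalPoint G (t / (m : ℝ)) (x m j t) (x m (j + 1) t))
    (hlim : ∀ t : ℝ, 0 ≤ t → Tendsto (fun m : ℕ => x m m t) atTop (𝓝 (c t)))
    {t s : ℝ} (ht : 0 < t) (hts : t < s) : SlopeLeDecrease G (c t) (c s) := by
  have hs : 0 < s := ht.trans hts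
  -- The approximation is from above because `flow_dist_le` then has a constant depending only on `c
  -- s`.
  choose r hr1 hr2 using fun n : ℕ =>
    exists_rat_btwn (show s / t < s / t + 1 / ((n : ℝ) + 1) by simp; positivity)
  have hr : Tendsto (fun n => t * (r n : ℝ)) atTop (𝓝 s) := by
    have h : Tendsto (fun n => (r n : ℝ)) atTop (𝓝 (s / t)) := by
      refine tendsto_of_tendsto_of_tendsto_of_le_of_le tendsto_const_nhds ?_
        (fun n => (hr1 n).le) (fun n => (hr2 n).le)
      simpa using tendsto_one_div_add_atTop_nhds_zero_nat.const_add (s / t)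
    have := h.const_mul t
    rwa [mul_div_cancel₀ _ ht.ne'] at this
  have hrs : ∀ n, s ≤ t * (r n : ℝ) := fun n => by
    have := (div_lt_iff₀ ht).1 (hr1 n); linarith
  have hlim2 : Tendsto (fun n => c (t * (r n : ℝ))) atTop (𝓝 (c s)) := by
    rw [tendsto_iff_dist_tendsto_zero]
    have h := ((hr.div_const s).sub_const 1).mul_const
      (s + (G (c 0)).toReal - (G (c s)).toReal + 1)
    rw [div_self hs.ne', sub_self, zero_mul] at h
    refine squeeze_zero (fun _ => dist_nonneg) (fun n => ?_) h
    rw [dist_comm]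
    exact flow_dist_le hM hG hbot hlsc h0 hx hlim hs (hrs n)
  refine SlopeLeDecrease.of_tendsto hlsc (flow_mem_dom hM hG hbot hlsc h0 hx hlim hs.le)
    tendsto_const_nhds hlim2
    (fun n => flow_mem_dom hM hG hbot hlsc h0 hx hlim (hs.le.trans (hrs n)))
    (fun ε hε => Eventually.of_forall fun _ => by linarith) fun n => ?_
  have h1 : (1 : ℝ) < (r n : ℝ) := ((one_lt_div ht).2 hts).trans (hr1 n)
  have h1' : 1 < r n := by exact_mod_cast h1
  obtain ⟨b, hb⟩ := Int.eq_ofNat_of_zero_le (Rat.num_nonneg.2 (zero_le_one.trans h1'.le))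
  have hrb : (r n : ℝ) = b / (r n).den := by
    rw [Rat.cast_def, hb]; simp
  have hden : (0 : ℝ) < (r n).den := by exact_mod_cast (r n).den_pos
  refine flow_slopeLeDecrease_of_commensurable hM hG hbot hlsc h0 hx hlim ht
    (a := (r n).den) (b := b) (r n).den_pos ?_ ?_
  · rw [hrb, one_lt_div hden] at h1
    exact_mod_cast h1.le
  · rw [hrb]; field_simp

end Flow

end HadamardFlow

theorem proposition3p2 {M : Type*} [MetricSpace M] (hM : HadamardFlow.IsHadamardSpace M)
    (G : M → EReal) (hG_bot : ∀ x, G x ≠ ⊥) (hG_convex : HadamardFlow.IsConvex G)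
    (hG_lsc : LowerSemicontinuous G)
    (c : ℝ → M) (hc : HadamardFlow.IsWeakGradientFlow G c) :
    (∀ t : ℝ, 0 ≤ t → c t ∈ HadamardFlow.Dom G) ∧
    (∀ t s : ℝ, 0 < t → t < s →
      (HadamardFlow.descendingSlope G (c t) : EReal) * (dist (c t) (c s) : EReal) ≥ G (c t) - G (c s) ∧
      G (c t) - G (c s) ≥ (HadamardFlow.descendingSlope G (c s) : EReal) * (dist (c t) (c s) : EReal)) ∧
    (∀ s : ℝ, 0 < s →
      (HadamardFlow.descendingSlope G (c 0) : EReal) * (dist (c 0) (c s) : EReal) ≥ G (c 0) - G (c s)) := by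
  obtain ⟨h0, x, hx, hlim⟩ := hc
  have hdom : ∀ t : ℝ, 0 ≤ t → c t ∈ HadamardFlow.Dom G := fun t ht =>
    HadamardFlow.flow_mem_dom hM hG_convex hG_bot hG_lsc h0 hx hlim ht
  refine ⟨hdom, fun t s ht hts => ⟨?_, ?_⟩, fun s hs => ?_⟩
  · exact hG_convex.sub_le_descendingSlope_mul hM hG_bot (hdom t ht.le) (hdom s (ht.trans hts).le)
  · exact (HadamardFlow.flow_slopeLeDecrease hM hG_convex hG_bot hG_lsc h0 hx hlim ht
      hts).descendingSlope_mul_le hG_bot (hdom t ht.le) (hdom s (ht.trans hts).le)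
  · exact hG_convex.sub_le_descendingSlope_mul hM hG_bot h0 (hdom s hs.le)
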